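/- Let $M\subset\mathbb{C}^d$ be a bounded, connected, embedded complex submanifold, and put $\partial M:=\overline{M}\setminus M$, with the closure taken in $\mathbb{C}^d$. Let $\mathsf{k}_M$ be the Kobayashi distance and $\kappa_M$ the Kobayashi--Royden metric of $M$ (normalized so that $\kappa_{\mathbb{D}}(z;v)=|v|/(1-|z|^2)$ and $\mathsf{k}_{\mathbb{D}}(0,z)=\tanh^{-1}|z|$ on the unit disc $\mathbb{D}$). For $\kappa>0$, a $(1,\kappa)$-almost-geodesic is an absolutely continuous curve $\sigma:[a,b]\to M$ such that $$|t-s|-\kappa\le \mathsf{k}_M(\sigma(t),\sigma(s))\le |t-s|+\kappa\quad\text{for all } s,t\in[a,b],$$ and $\kappa_M(\sigma(t);\sigma'(t))\le 1$ for almost every $t\in[a,b]$. Say that $M$ has the visibility property with respect to $(1,\kappa)$-almost-geodesics if (i) any two distinct points of $M$ can be joined by a $(1,\kappa)$-almost-geodesic, and (ii) for every pair of points $p\neq q$ in $\partial M$ there exist neighbourhoods $V$ of $p$ and $W$ of $q$ in $\mathbb{C}^d$ with $\overline V\cap\overline W=\emptyset$, and a compact set $K\subset M$, such that every $(1,\kappa)$-almost-geodesic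 in $M$ with initial point in $V$ and terminal point in $W$ intersects $K$. Theorem. Suppose that there exists $\kappa_0>0$ such that $M$ has the visibility property with respect to $(1,\kappa_0)$-almost-geodesics. Let $F:M\to M$ be a holomorphic map such that the sequence of iterates $(F^{\nu})_{\nu\ge1}$ converges, uniformly on compact subsets of $M$, to a holomorphic map $\psi:M\to\mathbb{C}^d$ with $\psi(M)\subset\partial M$. Then $\psi$ is constant. -/

import Mathlib

open Set Filter Topology MeasureTheory
open scoped ENNReal ComplexConjugate

namespace KobVis

noncomputable section

/-- `M` is an embedded complex submanifold of `ℂ^d` of complex dimension `n` (not necessarily a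
closed subset): around each of its points there are holomorphic coordinates of `ℂ^d` in which `M`
is an `n`-dimensional complex linear subspace. -/
def IsEmbeddedComplexSubmanifold {d : ℕ} (n : ℕ) (M : Set (EuclideanSpace ℂ (Fin d))) : Prop :=
  ∀ p ∈ M, ∃ (e : OpenPartialHomeomorph (EuclideanSpace ℂ (Fin d)) (EuclideanSpace ℂ (Fin d)))
    (L : Submodule ℂ (EuclideanSpace ℂ (Fin d))),
    Module.finrank ℂ L = n ∧ p ∈ e.source ∧
      DifferentiableOn ℂ e e.source ∧ DifferentiableOn ℂ e.symm e.target ∧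
      ∀ x ∈ e.source, x ∈ M ↔ e x ∈ L

/-- The boundary `∂M = closure M \ M`. -/
def bdry {d : ℕ} (M : Set (EuclideanSpace ℂ (Fin d))) : Set (EuclideanSpace ℂ (Fin d)) :=
  closure M \ M

/-- `f` is holomorphic on the submanifold `M`: near each point of `M` it is the restriction to `M`
of a holomorphic map defined on an open subset of `ℂ^d`. The values of `f` off `M` are
irrelevant. -/
def HolomorphicOnSubmanifold {d m : ℕ} (M : Set (EuclideanSpace ℂ (Fin d)))
    (f : EuclideanSpace ℂ (Fin d) → EuclideanSpace ℂ (Fin m)) : Prop :=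
  ∀ p ∈ M, ∃ (U : Set (EuclideanSpace ℂ (Fin d)))
    (g : EuclideanSpace ℂ (Fin d) → EuclideanSpace ℂ (Fin m)),
    IsOpen U ∧ p ∈ U ∧ DifferentiableOn ℂ g U ∧ EqOn f g (U ∩ M)

/-- `φ` restricts to a holomorphic map from the open unit disc to `M`. -/
def IsHolomorphicDisc {d : ℕ} (M : Set (EuclideanSpace ℂ (Fin d)))
    (φ : ℂ → EuclideanSpace ℂ (Fin d)) : Prop :=
  DifferentiableOn ℂ φ (Metric.ball 0 1) ∧ MapsTo φ (Metric.ball 0 1) M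

/-- The Poincaré distance of the open unit disc, `tanh⁻¹ |(a - b) / (1 - conj a * b)|`, that is,
the distance of the metric `|dz| / (1 - |z|²)`. -/
def poincareDist (a b : ℂ) : ℝ :=
  Real.artanh ‖(a - b) / (1 - conj a * b)‖

/-- `ℓ` is the length of a chain of `N` holomorphic discs in `M` from `p` to `q`: the `i`-th disc
`φ i` joins `z i = φ i (a i)` to `z (i + 1) = φ i (b i)`. -/
def IsChainLength {d : ℕ} (M : Set (EuclideanSpace ℂ (Fin d))) (p q : EuclideanSpace ℂ (Fin d))
    (ℓ : ℝ) : Prop :=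
  ∃ (N : ℕ) (z : ℕ → EuclideanSpace ℂ (Fin d)) (φ : ℕ → ℂ → EuclideanSpace ℂ (Fin d))
    (a b : ℕ → ℂ),
    z 0 = p ∧ z N = q ∧
    (∀ i < N, IsHolomorphicDisc M (φ i) ∧ a i ∈ Metric.ball (0 : ℂ) 1 ∧
      b i ∈ Metric.ball (0 : ℂ) 1 ∧ φ i (a i) = z i ∧ φ i (b i) = z (i + 1)) ∧
    ℓ = ∑ i ∈ Finset.range N, poincareDist (a i) (b i)

/-- The Kobayashi (pseudo)distance of `M`: the infimum of the lengths of chains of holomorphic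
discs (`⊤` when there is no chain, which does not happen on a connected `M`). -/
def kobayashiDist {d : ℕ} (M : Set (EuclideanSpace ℂ (Fin d)))
    (p q : EuclideanSpace ℂ (Fin d)) : ℝ≥0∞ :=
  ⨅ (ℓ : ℝ) (_ : IsChainLength M p q ℓ), ENNReal.ofReal ℓ

/-- The Kobayashi–Royden (pseudo)metric of `M`: the infimum of `|ξ|` over all holomorphic discs
`φ` in `M` with `φ 0 = p` and `φ'(0) ξ = v` (`⊤` when there is none, which does not happen for `v`
tangent to `M` at `p`). -/
def kobayashiMetric {d : ℕ} (M : Set (EuclideanSpace ℂ (Fin d)))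
    (p v : EuclideanSpace ℂ (Fin d)) : ℝ≥0∞ :=
  ⨅ (φ : ℂ → EuclideanSpace ℂ (Fin d)) (ξ : ℂ)
    (_ : IsHolomorphicDisc M φ ∧ φ 0 = p ∧ ξ • deriv φ 0 = v), ENNReal.ofReal ‖ξ‖

/-- The curve `σ : [a, b] → M` is a `(lam, κ)`-almost-geodesic of `M`. The values of `σ` off
`[a, b]` are irrelevant. -/
structure IsAlmostGeodesic {d : ℕ} (M : Set (EuclideanSpace ℂ (Fin d))) (lam κ a b : ℝ)
    (σ : ℝ → EuclideanSpace ℂ (Fin d)) : Prop where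
  le : a ≤ b
  mapsTo : MapsTo σ (Icc a b) M
  lower : ∀ s ∈ Icc a b, ∀ t ∈ Icc a b,
    ENNReal.ofReal (1 / lam * |t - s| - κ) ≤ kobayashiDist M (σ t) (σ s)
  upper : ∀ s ∈ Icc a b, ∀ t ∈ Icc a b,
    kobayashiDist M (σ t) (σ s) ≤ ENNReal.ofReal (lam * |t - s| + κ)
  absCont : AbsolutelyContinuousOnInterval σ a b
  speed : ∀ᵐ t ∂(volume.restrict (Icc a b)),
    DifferentiableAt ℝ σ t ∧ kobayashiMetric M (σ t) (deriv σ t) ≤ ENNReal.ofReal lam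

/-- `M` has the visibility property with respect to `(lam, κ)`-almost-geodesics. -/
structure HasVisibility {d : ℕ} (M : Set (EuclideanSpace ℂ (Fin d))) (lam κ : ℝ) : Prop where
  joined : ∀ p ∈ M, ∀ q ∈ M, p ≠ q →
    ∃ (a b : ℝ) (σ : ℝ → EuclideanSpace ℂ (Fin d)),
      IsAlmostGeodesic M lam κ a b σ ∧ σ a = p ∧ σ b = q
  visible : ∀ p ∈ bdry M, ∀ q ∈ bdry M, p ≠ q →
    ∃ V ∈ 𝓝 p, ∃ W ∈ 𝓝 q, ∃ K : Set (EuclideanSpace ℂ (Fin d)),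
      IsCompact K ∧ K ⊆ M ∧ closure V ∩ closure W = ∅ ∧
      ∀ (a b : ℝ) (σ : ℝ → EuclideanSpace ℂ (Fin d)), IsAlmostGeodesic M lam κ a b σ →
        σ a ∈ V → σ b ∈ W → (σ '' Icc a b ∩ K).Nonempty

end

end KobVis

/-!
The constant `κ` leaves room for very short almost-geodesics: a curve of speed at most `lam`,
defined on an interval of length at most `lam * κ` and whose points are at Kobayashi distance at
most `κ` from each other, is a `(lam, κ)`-almost-geodesic, because the lower bound then holds
trivially. Short radial segments of holomorphic discs are such curves, and holomorphic maps send
discs to discs. Let holomorphic maps `f i : M → N` converge to `ψ : M → ∂N`. If `ψ` took distinct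
values at the two ends of a short radial segment, then the images of the segment under the `f i`
would be almost-geodesics joining neighbourhoods of two distinct boundary points, so that by
visibility they would meet a fixed compact subset of `N`; but they converge uniformly to a curve in
`∂N`. Finally, all points of `M` near a given one are joined to it by radial segments of discs, of
one and the same short length, whence `ψ` is locally constant.
-/

namespace KobVis

section

variable {d m : ℕ} {M : Set (EuclideanSpace ℂ (Fin d))} {N : Set (EuclideanSpace ℂ (Fin m))}

/-! ### Holomorphic maps on submanifolds -/

theorem HolomorphicOnSubmanifold.continuousOn
    {f : EuclideanSpace ℂ (Fin d) → EuclideanSpace ℂ (Fin m)}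
    (hf : HolomorphicOnSubmanifold M f) : ContinuousOn f M := by
  intro p hp
  obtain ⟨U, g, hU, hpU, hg, hfg⟩ := hf p hp
  have hgp : ContinuousWithinAt g M p :=
    (hg.differentiableAt (hU.mem_nhds hpU)).continuousAt.continuousWithinAt
  refine hgp.congr_of_eventuallyEq ?_ (hfg ⟨hpU, hp⟩)
  filter_upwards [mem_nhdsWithin_of_mem_nhds (hU.mem_nhds hpU), self_mem_nhdsWithin] with x hxU hxM
  exact hfg ⟨hxU, hxM⟩

theorem HolomorphicOnSubmanifold.comp {k : ℕ}
    {g : EuclideanSpace ℂ (Fin m) → EuclideanSpace ℂ (Fin k)}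
    {f : EuclideanSpace ℂ (Fin d) → EuclideanSpace ℂ (Fin m)}
    (hg : HolomorphicOnSubmanifold N g) (hf : HolomorphicOnSubmanifold M f)
    (hfN : MapsTo f M N) : HolomorphicOnSubmanifold M (g ∘ f) := by
  intro p hp
  obtain ⟨U, f', hU, hpU, hf', hff'⟩ := hf p hp
  obtain ⟨V, g', hV, hpV, hg', hgg'⟩ := hg (f p) (hfN hp)
  refine ⟨U ∩ f' ⁻¹' V, g' ∘ f', hf'.continuousOn.isOpen_inter_preimage hU hV,
    ⟨hpU, ?_⟩, hg'.comp (hf'.mono inter_subset_left) fun x hx => hx.2, ?_⟩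
  · rwa [mem_preimage, ← hff' ⟨hpU, hp⟩]
  · rintro x ⟨⟨hxU, hxV⟩, hxM⟩
    have hfx : f x = f' x := hff' ⟨hxU, hxM⟩
    rw [Function.comp_apply, Function.comp_apply, ← hfx]
    exact hgg' ⟨hfx ▸ hxV, hfN hxM⟩

theorem HolomorphicOnSubmanifold.iterate
    {F : EuclideanSpace ℂ (Fin d) → EuclideanSpace ℂ (Fin d)}
    (hF : HolomorphicOnSubmanifold M F) (hFM : MapsTo F M M) (ν : ℕ) :
    HolomorphicOnSubmanifold M F^[ν] := by
  induction ν with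
  | zero =>
    exact fun p _ => ⟨univ, id, isOpen_univ, mem_univ p, differentiableOn_id, fun _ _ => rfl⟩
  | succ ν ih => exact ih.comp hF hFM

theorem HolomorphicOnSubmanifold.comp_isHolomorphicDisc
    {f : EuclideanSpace ℂ (Fin d) → EuclideanSpace ℂ (Fin m)} {φ : ℂ → EuclideanSpace ℂ (Fin d)}
    (hf : HolomorphicOnSubmanifold M f) (hfN : MapsTo f M N) (hφ : IsHolomorphicDisc M φ) :
    IsHolomorphicDisc N (f ∘ φ) := by
  refine ⟨fun z hz => ?_, hfN.comp hφ.2⟩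
  obtain ⟨U, g, hU, hzU, hg, hfg⟩ := hf (φ z) (hφ.2 hz)
  have hφz : DifferentiableAt ℂ φ z := hφ.1.differentiableAt (Metric.isOpen_ball.mem_nhds hz)
  have hgz : DifferentiableAt ℂ g (φ z) := hg.differentiableAt (hU.mem_nhds hzU)
  refine ((hgz.comp z hφz).congr_of_eventuallyEq ?_).differentiableWithinAt
  filter_upwards [hφz.continuousAt.preimage_mem_nhds (hU.mem_nhds hzU),
    Metric.isOpen_ball.mem_nhds hz] with w hwU hw
  exact hfg ⟨hwU, hφ.2 hw⟩

theorem IsEmbeddedComplexSubmanifold.eventually_exists_isHolomorphicDisc {n : ℕ}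
    (hM : IsEmbeddedComplexSubmanifold n M) {p : EuclideanSpace ℂ (Fin d)} (hp : p ∈ M)
    {δ : ℂ} (hδ : δ ≠ 0) :
    ∀ᶠ x in 𝓝[M] p, ∃ φ, IsHolomorphicDisc M φ ∧ φ 0 = p ∧ φ δ = x := by
  obtain ⟨e, L, -, hpe, -, he_symm, hML⟩ := hM p hp
  obtain ⟨r, hr, hball⟩ := Metric.isOpen_iff.1 e.open_target (e p) (e.map_source hpe)
  have hδr : 0 < ‖δ‖ * r := mul_pos (norm_pos_iff.2 hδ) hr
  filter_upwards [mem_nhdsWithin_of_mem_nhds (e.open_source.mem_nhds hpe),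
    mem_nhdsWithin_of_mem_nhds
      ((e.continuousAt hpe).preimage_mem_nhds (Metric.ball_mem_nhds _ hδr)),
    self_mem_nhdsWithin] with x hxe hx hxM
  set u := δ⁻¹ • (e x - e p) with hu
  have hur : ‖u‖ < r := by
    rw [hu, norm_smul, norm_inv, inv_mul_lt_iff₀ (norm_pos_iff.2 hδ)]
    exact mem_ball_iff_norm.1 hx
  have hepL : e p ∈ L := (hML p hpe).1 hp
  have huL : u ∈ L := L.smul_mem _ (L.sub_mem ((hML x hxe).1 hxM) hepL)
  have hmaps : MapsTo (fun z : ℂ => e p + z • u) (Metric.ball 0 1) e.target := by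
    intro z hz
    refine hball ?_
    rw [mem_ball_iff_norm, add_sub_cancel_left, norm_smul]
    exact (mul_le_of_le_one_left (norm_nonneg u) (mem_ball_zero_iff.1 hz).le).trans_lt hur
  refine ⟨fun z => e.symm (e p + z • u), ⟨he_symm.comp (by fun_prop) hmaps, fun z hz => ?_⟩,
    ?_, ?_⟩
  · rw [hML _ (e.map_target (hmaps hz)), e.right_inv (hmaps hz)]
    exact L.add_mem hepL (L.smul_mem _ huL)
  · simp [e.left_inv hpe]
  · simp [hu, smul_smul, mul_inv_cancel₀ hδ, e.left_inv hxe]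

/-! ### Upper bounds for the Kobayashi distance and metric -/

theorem IsHolomorphicDisc.kobayashiDist_le_poincareDist {φ : ℂ → EuclideanSpace ℂ (Fin d)}
    (hφ : IsHolomorphicDisc M φ) {a b : ℂ} (ha : a ∈ Metric.ball (0 : ℂ) 1)
    (hb : b ∈ Metric.ball (0 : ℂ) 1) :
    kobayashiDist M (φ a) (φ b) ≤ ENNReal.ofReal (poincareDist a b) := by
  refine iInf₂_le _ ⟨1, fun i => if i = 0 then φ a else φ b, fun _ => φ, fun _ => a, fun _ => b,
    by simp, by simp, fun i hi => ?_, by simp⟩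
  obtain rfl : i = 0 := by omega
  exact ⟨hφ, ha, hb, by simp, by simp⟩

theorem poincareDist_zero_left (b : ℂ) : poincareDist 0 b = Real.artanh ‖b‖ := by
  simp [poincareDist]

theorem isHolomorphicDisc_comp_add_mul {φ : ℂ → EuclideanSpace ℂ (Fin d)} {a : ℂ} {r : ℝ}
    (hr : 0 < r) (hφ : DifferentiableOn ℂ φ (Metric.ball a r))
    (hφM : MapsTo φ (Metric.ball a r) M) :
    IsHolomorphicDisc M fun z => φ (a + r * z) := by
  have hmaps : MapsTo (fun z : ℂ => a + r * z) (Metric.ball 0 1) (Metric.ball a r) := by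
    intro z hz
    rw [mem_ball_iff_norm, add_sub_cancel_left, norm_mul, Complex.norm_of_nonneg hr.le]
    exact mul_lt_of_lt_one_right hr (mem_ball_zero_iff.1 hz)
  exact ⟨hφ.comp (by fun_prop) hmaps, hφM.comp hmaps⟩

theorem kobayashiDist_le_artanh_dist_div {φ : ℂ → EuclideanSpace ℂ (Fin d)} {a b : ℂ} {r : ℝ}
    (hφ : DifferentiableOn ℂ φ (Metric.ball a r)) (hφM : MapsTo φ (Metric.ball a r) M)
    (hb : b ∈ Metric.ball a r) :
    kobayashiDist M (φ a) (φ b) ≤ ENNReal.ofReal (Real.artanh (dist b a / r)) := by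
  have hr : 0 < r := Metric.pos_of_mem_ball hb
  have hr' : (r : ℂ) ≠ 0 := Complex.ofReal_ne_zero.2 hr.ne'
  have hnorm : ‖(b - a) / r‖ = dist b a / r := by
    rw [norm_div, Complex.norm_of_nonneg hr.le, dist_eq_norm]
  have hmem : (b - a) / r ∈ Metric.ball (0 : ℂ) 1 := by
    rw [mem_ball_zero_iff, hnorm, div_lt_one hr]
    exact hb
  have h := (isHolomorphicDisc_comp_add_mul hr hφ hφM).kobayashiDist_le_poincareDist
    (Metric.mem_ball_self one_pos) hmem
  rwa [poincareDist_zero_left, hnorm, mul_zero, add_zero, mul_div_cancel₀ _ hr',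
    add_sub_cancel] at h

theorem kobayashiMetric_smul_deriv_le {φ : ℂ → EuclideanSpace ℂ (Fin d)} {a : ℂ} {r : ℝ}
    (hr : 0 < r) (hφ : DifferentiableOn ℂ φ (Metric.ball a r))
    (hφM : MapsTo φ (Metric.ball a r) M) (v : ℂ) :
    kobayashiMetric M (φ a) (v • deriv φ a) ≤ ENNReal.ofReal (‖v‖ / r) := by
  have hr' : (r : ℂ) ≠ 0 := Complex.ofReal_ne_zero.2 hr.ne'
  have hderiv : deriv (fun z : ℂ => φ (a + r * z)) 0 = (r : ℂ) • deriv φ a := by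
    have hφa : HasDerivAt φ (deriv φ a) (a + r * 0) := by
      simpa using (hφ.differentiableAt (Metric.ball_mem_nhds a hr)).hasDerivAt
    have haff : HasDerivAt (fun z : ℂ => a + r * z) r 0 := by
      simpa using ((hasDerivAt_id (0 : ℂ)).const_mul (r : ℂ)).const_add a
    exact (hφa.scomp 0 haff).deriv
  have hnorm : ‖v / r‖ = ‖v‖ / r := by rw [norm_div, Complex.norm_of_nonneg hr.le]
  rw [← hnorm]
  refine (iInf₂_le (fun z : ℂ => φ (a + r * z)) (v / r)).trans
    (iInf_le _ ⟨isHolomorphicDisc_comp_add_mul hr hφ hφM, by simp, ?_⟩)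
  rw [hderiv, smul_smul, div_mul_cancel₀ _ hr']

theorem differentiableAt_and_kobayashiMetric_deriv_le {φ : ℂ → EuclideanSpace ℂ (Fin d)}
    {c t r : ℝ} (hr : 0 < r) (hφ : DifferentiableOn ℂ φ (Metric.ball ((c * t : ℝ) : ℂ) r))
    (hφM : MapsTo φ (Metric.ball ((c * t : ℝ) : ℂ) r) M) :
    DifferentiableAt ℝ (fun s : ℝ => φ (c * s : ℝ)) t ∧
      kobayashiMetric M (φ (c * t : ℝ)) (deriv (fun s : ℝ => φ (c * s : ℝ)) t) ≤
        ENNReal.ofReal (|c| / r) := by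
  have hlin : HasDerivAt (fun s : ℝ => ((c * s : ℝ) : ℂ)) (c : ℂ) t := by
    simpa using ((hasDerivAt_id t).const_mul c).ofReal_comp
  have hderiv : HasDerivAt (fun s : ℝ => φ (c * s : ℝ)) ((c : ℂ) • deriv φ (c * t : ℝ)) t :=
    (hφ.differentiableAt (Metric.ball_mem_nhds _ hr)).hasDerivAt.scomp t hlin
  refine ⟨hderiv.differentiableAt, ?_⟩
  rw [hderiv.deriv, ← Real.norm_eq_abs, ← Complex.norm_real]
  exact kobayashiMetric_smul_deriv_le hr hφ hφM c

/-! ### Short almost-geodesics -/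

theorem isAlmostGeodesic_of_kobayashiDist_le {lam κ a b : ℝ} {σ : ℝ → EuclideanSpace ℂ (Fin d)}
    (hlam : 0 < lam) (hab : a ≤ b) (hlen : b - a ≤ lam * κ) (hσM : MapsTo σ (Icc a b) M)
    (hdist : ∀ s ∈ Icc a b, ∀ t ∈ Icc a b, kobayashiDist M (σ t) (σ s) ≤ ENNReal.ofReal κ)
    (hac : AbsolutelyContinuousOnInterval σ a b)
    (hspeed : ∀ᵐ t ∂(volume.restrict (Icc a b)),
      DifferentiableAt ℝ σ t ∧ kobayashiMetric M (σ t) (deriv σ t) ≤ ENNReal.ofReal lam) :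
    IsAlmostGeodesic M lam κ a b σ where
  le := hab
  mapsTo := hσM
  lower s hs t ht := by
    have hts : |t - s| ≤ lam * κ := (abs_sub_le_of_le_of_le ht.1 ht.2 hs.1 hs.2).trans hlen
    have : 1 / lam * |t - s| ≤ κ := by rwa [one_div, inv_mul_le_iff₀ hlam]
    rw [ENNReal.ofReal_of_nonpos (sub_nonpos.2 this)]
    exact zero_le
  upper s hs t ht := (hdist s hs t ht).trans <| ENNReal.ofReal_le_ofReal <|
    le_add_of_nonneg_left (mul_nonneg hlam.le (abs_nonneg _))
  absCont := hac
  speed := hspeed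

/-- The speed is `lam` because the unit disc contains the discs of radius `1 / 2` centred at the
points of `[0, 1 / 2]`. -/
theorem IsHolomorphicDisc.isAlmostGeodesic_radial {φ : ℂ → EuclideanSpace ℂ (Fin d)}
    (hφ : IsHolomorphicDisc M φ) {lam κ ℓ : ℝ} (hlam : 0 < lam) (hℓ : 0 ≤ ℓ)
    (hℓκ : ℓ ≤ lam * κ) (hℓtanh : lam * ℓ ≤ Real.tanh κ) :
    IsAlmostGeodesic M lam κ 0 ℓ fun t => φ (lam / 2 * t : ℝ) := by
  have hℓ1 : lam * ℓ < 1 := hℓtanh.trans_lt (Real.tanh_lt_one κ)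
  have hball : ∀ t ∈ Icc 0 ℓ, Metric.ball ((lam / 2 * t : ℝ) : ℂ) (1 / 2) ⊆ Metric.ball 0 1 := by
    intro t ht
    refine Metric.ball_subset_ball' ?_
    rw [dist_zero_right, Complex.norm_of_nonneg (by have := ht.1; positivity)]
    linarith [mul_le_mul_of_nonneg_left ht.2 hlam.le]
  have hmaps : MapsTo (fun t : ℝ => ((lam / 2 * t : ℝ) : ℂ)) (Icc 0 ℓ) (Metric.ball 0 1) :=
    fun t ht => hball t ht (Metric.mem_ball_self one_half_pos)
  refine isAlmostGeodesic_of_kobayashiDist_le hlam hℓ (by rwa [sub_zero]) (hφ.2.comp hmaps)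
    (fun s hs t ht => ?_) ?_ ?_
  · have hst : dist ((lam / 2 * s : ℝ) : ℂ) (lam / 2 * t : ℝ) / (1 / 2) = lam * |s - t| := by
      rw [dist_eq_norm, ← Complex.ofReal_sub, Complex.norm_real, Real.norm_eq_abs, ← mul_sub,
        abs_mul, abs_of_pos (half_pos hlam)]
      ring
    have hst_le : lam * |s - t| ≤ lam * ℓ := by
      gcongr
      simpa using abs_sub_le_of_le_of_le hs.1 hs.2 ht.1 ht.2
    have hmem : ((lam / 2 * s : ℝ) : ℂ) ∈ Metric.ball ((lam / 2 * t : ℝ) : ℂ) (1 / 2) := by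
      rw [Metric.mem_ball, ← div_lt_one one_half_pos, hst]
      exact hst_le.trans_lt hℓ1
    refine (kobayashiDist_le_artanh_dist_div (hφ.1.mono (hball t ht))
      (hφ.2.mono_left (hball t ht)) hmem).trans (ENNReal.ofReal_le_ofReal ?_)
    rw [hst, ← Real.artanh_tanh κ]
    exact Real.artanh_le_artanh (neg_one_lt_zero.trans_le (by positivity)) (Real.tanh_lt_one κ)
      (hst_le.trans hℓtanh)
  · refine ContDiffOn.absolutelyContinuousOnInterval ?_
    rw [uIcc_of_le hℓ]
    exact ((hφ.1.contDiffOn Metric.isOpen_ball).restrict_scalars ℝ).comp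
      (Complex.ofRealCLM.contDiff.comp (contDiff_const.mul contDiff_id)).contDiffOn hmaps
  · refine (ae_restrict_iff' measurableSet_Icc).2 (Eventually.of_forall fun t ht => ?_)
    have hspeed := differentiableAt_and_kobayashiMetric_deriv_le one_half_pos
      (hφ.1.mono (hball t ht)) (hφ.2.mono_left (hball t ht))
    rwa [abs_of_pos (half_pos hlam), div_div_div_cancel_right₀ two_ne_zero, div_one] at hspeed

theorem tanh_pos_of_pos {x : ℝ} (hx : 0 < x) : 0 < Real.tanh x := by
  rw [Real.tanh_eq_sinh_div_cosh]
  exact div_pos (Real.sinh_pos_iff.2 hx) (Real.cosh_pos x)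

theorem exists_pos_le_mul_and_mul_le_tanh {lam κ : ℝ} (hlam : 0 < lam) (hκ : 0 < κ) :
    ∃ ℓ : ℝ, 0 < ℓ ∧ ℓ ≤ lam * κ ∧ lam * ℓ ≤ Real.tanh κ := by
  refine ⟨min (lam * κ) (Real.tanh κ / lam),
    lt_min (mul_pos hlam hκ) (div_pos (tanh_pos_of_pos hκ) hlam), min_le_left _ _, ?_⟩
  rw [mul_comm, ← le_div_iff₀ hlam]
  exact min_le_right _ _

/-! ### Visibility and limits of almost-geodesics -/

/-- The visibility condition for the pair `p`, `q`: the `(lam, κ)`-almost-geodesics of `M` from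
points near `p` to points near `q` all meet some fixed compact subset of `M`. Disjointness of the
closures of the neighbourhoods is not imposed, as for `p ≠ q` it is achieved by shrinking them. -/
def IsVisiblePair (M : Set (EuclideanSpace ℂ (Fin d))) (lam κ : ℝ)
    (p q : EuclideanSpace ℂ (Fin d)) : Prop :=
  ∃ V ∈ 𝓝 p, ∃ W ∈ 𝓝 q, ∃ K : Set (EuclideanSpace ℂ (Fin d)), IsCompact K ∧ K ⊆ M ∧
    ∀ (a b : ℝ) (σ : ℝ → EuclideanSpace ℂ (Fin d)), IsAlmostGeodesic M lam κ a b σ →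
      σ a ∈ V → σ b ∈ W → (σ '' Icc a b ∩ K).Nonempty

theorem HasVisibility.pairwise_isVisiblePair {lam κ : ℝ} (hM : HasVisibility M lam κ) :
    (bdry M).Pairwise (IsVisiblePair M lam κ) := by
  intro p hp q hq hpq
  obtain ⟨V, hV, W, hW, K, hK, hKM, -, hmeet⟩ := hM.visible p hp q hq hpq
  exact ⟨V, hV, W, hW, K, hK, hKM, hmeet⟩

theorem eventually_mapsTo_of_tendstoUniformlyOn {X Y ι : Type*} [UniformSpace Y] {l : Filter ι}
    {f : ι → X → Y} {g : X → Y} {s : Set X} {U : Set Y} (hfg : TendstoUniformlyOn f g l s)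
    (hg : IsCompact (g '' s)) (hU : IsOpen U) (hgU : MapsTo g s U) :
    ∀ᶠ i in l, MapsTo (f i) s U := by
  obtain ⟨R, hR, -, hRU⟩ := lebesgue_number_of_compact_open hg hU hgU.image_subset
  filter_upwards [hfg R hR] with i hi x hx
  exact hRU (g x) (mem_image_of_mem g hx) (hi x hx)

theorem not_isVisiblePair_of_tendstoUniformlyOn {lam κ a b : ℝ} {ι : Type*} {l : Filter ι}
    [l.NeBot] {σ : ι → ℝ → EuclideanSpace ℂ (Fin d)} {τ : ℝ → EuclideanSpace ℂ (Fin d)}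
    (hσ : ∀ i, IsAlmostGeodesic M lam κ a b (σ i)) (hτM : MapsTo τ (Icc a b) Mᶜ)
    (hlim : TendstoUniformlyOn σ τ l (Icc a b)) : ¬ IsVisiblePair M lam κ (τ a) (τ b) := by
  rintro ⟨V, hV, W, hW, K, hK, hKM, hmeet⟩
  obtain ⟨i₀⟩ := l.nonempty_of_neBot
  have hab : a ≤ b := (hσ i₀).le
  have hcont : ContinuousOn τ (Icc a b) := by
    refine hlim.continuousOn (Frequently.of_forall fun i => ?_)
    rw [← uIcc_of_le hab]
    exact (hσ i).absCont.uniformContinuousOn.continuousOn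
  have havoid : ∀ᶠ i in l, MapsTo (σ i) (Icc a b) Kᶜ :=
    eventually_mapsTo_of_tendstoUniformlyOn hlim (isCompact_Icc.image_of_continuousOn hcont)
      hK.isClosed.isOpen_compl (hτM.mono_right (compl_subset_compl.2 hKM))
  obtain ⟨i, hiK, hiV, hiW⟩ := (havoid.and
    (((hlim.tendsto_at (left_mem_Icc.2 hab)).eventually_mem hV).and
      ((hlim.tendsto_at (right_mem_Icc.2 hab)).eventually_mem hW))).exists
  obtain ⟨_, ⟨t, ht, rfl⟩, htK⟩ := hmeet a b (σ i) (hσ i) hiV hiW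
  exact hiK ht htK

section

variable {lam κ : ℝ} {ι : Type*} {l : Filter ι} [l.NeBot]
  {f : ι → EuclideanSpace ℂ (Fin d) → EuclideanSpace ℂ (Fin m)}
  {ψ : EuclideanSpace ℂ (Fin d) → EuclideanSpace ℂ (Fin m)}

theorem apply_zero_eq_apply_of_isHolomorphicDisc (hlam : 0 < lam)
    (hvis : (bdry N).Pairwise (IsVisiblePair N lam κ))
    (hf : ∀ i, HolomorphicOnSubmanifold M (f i)) (hfN : ∀ i, MapsTo (f i) M N)
    (hψN : MapsTo ψ M (bdry N))
    (hconv : ∀ K : Set (EuclideanSpace ℂ (Fin d)), IsCompact K → K ⊆ M →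
      TendstoUniformlyOn f ψ l K)
    {ℓ : ℝ} (hℓ : 0 ≤ ℓ) (hℓκ : ℓ ≤ lam * κ) (hℓtanh : lam * ℓ ≤ Real.tanh κ)
    {φ : ℂ → EuclideanSpace ℂ (Fin d)} (hφ : IsHolomorphicDisc M φ) :
    ψ (φ 0) = ψ (φ (lam / 2 * ℓ : ℝ)) := by
  set σ : ℝ → EuclideanSpace ℂ (Fin d) := fun t => φ (lam / 2 * t : ℝ) with hσ
  have hσgeo : IsAlmostGeodesic M lam κ 0 ℓ σ := hφ.isAlmostGeodesic_radial hlam hℓ hℓκ hℓtanh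
  have hσcont : ContinuousOn σ (Icc 0 ℓ) := by
    rw [← uIcc_of_le hℓ]
    exact hσgeo.absCont.uniformContinuousOn.continuousOn
  have hlim : TendstoUniformlyOn (fun i => f i ∘ σ) (ψ ∘ σ) l (Icc 0 ℓ) :=
    ((hconv _ (isCompact_Icc.image_of_continuousOn hσcont) hσgeo.mapsTo.image_subset).comp σ).mono
      (subset_preimage_image σ _)
  have hnot : ¬ IsVisiblePair N lam κ (ψ (σ 0)) (ψ (σ ℓ)) :=
    not_isVisiblePair_of_tendstoUniformlyOn
      (fun i => ((hf i).comp_isHolomorphicDisc (hfN i) hφ).isAlmostGeodesic_radial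
        hlam hℓ hℓκ hℓtanh)
      (fun t ht => (hψN (hσgeo.mapsTo ht)).2) hlim
  have heq : ψ (σ 0) = ψ (σ ℓ) := by
    by_contra hne
    exact hnot (hvis (hψN (hσgeo.mapsTo (left_mem_Icc.2 hℓ)))
      (hψN (hσgeo.mapsTo (right_mem_Icc.2 hℓ))) hne)
  simpa [hσ] using heq

theorem isLocallyConstant_domRestrict_of_mapsTo_bdry {n : ℕ}
    (hM : IsEmbeddedComplexSubmanifold n M) (hlam : 0 < lam) (hκ : 0 < κ)
    (hvis : (bdry N).Pairwise (IsVisiblePair N lam κ))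
    (hf : ∀ i, HolomorphicOnSubmanifold M (f i)) (hfN : ∀ i, MapsTo (f i) M N)
    (hψN : MapsTo ψ M (bdry N))
    (hconv : ∀ K : Set (EuclideanSpace ℂ (Fin d)), IsCompact K → K ⊆ M →
      TendstoUniformlyOn f ψ l K) : IsLocallyConstant (M.domRestrict ψ) := by
  obtain ⟨ℓ, hℓ, hℓκ, hℓtanh⟩ := exists_pos_le_mul_and_mul_le_tanh hlam hκ
  have hδ : ((lam / 2 * ℓ : ℝ) : ℂ) ≠ 0 :=
    Complex.ofReal_ne_zero.2 (mul_pos (half_pos hlam) hℓ).ne'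
  refine (IsLocallyConstant.iff_eventually_eq _).2 fun p => ?_
  have hdisc := hM.eventually_exists_isHolomorphicDisc p.2 hδ
  rw [← map_nhds_subtype_val, eventually_map] at hdisc
  filter_upwards [hdisc] with x ⟨φ, hφ, hφp, hφx⟩
  rw [domRestrict_apply, domRestrict_apply, ← hφp, ← hφx]
  exact (apply_zero_eq_apply_of_isHolomorphicDisc hlam hvis hf hfN hψN hconv hℓ.le hℓκ hℓtanh
    hφ).symm

end

end

end KobVis

theorem mainTheorem11_general {d m n : ℕ} {M : Set (EuclideanSpace ℂ (Fin d))}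
    {N : Set (EuclideanSpace ℂ (Fin m))} (hM : KobVis.IsEmbeddedComplexSubmanifold n M)
    (hconn : IsPreconnected M) {lam κ : ℝ} (hlam : 0 < lam) (hκ : 0 < κ)
    (hvis : (KobVis.bdry N).Pairwise (KobVis.IsVisiblePair N lam κ))
    {ι : Type*} {l : Filter ι} [l.NeBot]
    {f : ι → EuclideanSpace ℂ (Fin d) → EuclideanSpace ℂ (Fin m)}
    (hf : ∀ i, KobVis.HolomorphicOnSubmanifold M (f i)) (hfN : ∀ i, MapsTo (f i) M N)
    {ψ : EuclideanSpace ℂ (Fin d) → EuclideanSpace ℂ (Fin m)}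
    (hψN : MapsTo ψ M (KobVis.bdry N))
    (hconv : ∀ K : Set (EuclideanSpace ℂ (Fin d)), IsCompact K → K ⊆ M →
      TendstoUniformlyOn f ψ l K) :
    ∃ ξ : EuclideanSpace ℂ (Fin m), ∀ z ∈ M, ψ z = ξ := by
  have := Subtype.preconnectedSpace hconn
  obtain ⟨ξ, hξ⟩ := (KobVis.isLocallyConstant_domRestrict_of_mapsTo_bdry
    hM hlam hκ hvis hf hfN hψN hconv).exists_eq_const
  exact ⟨ξ, fun z hz => congrFun hξ ⟨z, hz⟩⟩

theorem mainTheorem11 {d n : ℕ} (M : Set (EuclideanSpace ℂ (Fin d)))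
    (hM : KobVis.IsEmbeddedComplexSubmanifold n M)
    (hbdd : Bornology.IsBounded M) (hconn : IsConnected M)
    (κ₀ : ℝ) (hκ₀ : 0 < κ₀) (hvis : KobVis.HasVisibility M 1 κ₀)
    (F : EuclideanSpace ℂ (Fin d) → EuclideanSpace ℂ (Fin d))
    (hF : KobVis.HolomorphicOnSubmanifold M F) (hFM : Set.MapsTo F M M)
    (ψ : EuclideanSpace ℂ (Fin d) → EuclideanSpace ℂ (Fin d))
    (hψ : KobVis.HolomorphicOnSubmanifold M ψ) (hψM : Set.MapsTo ψ M (KobVis.bdry M))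
    (hconv : ∀ K : Set (EuclideanSpace ℂ (Fin d)), IsCompact K → K ⊆ M →
      TendstoUniformlyOn (fun ν : ℕ => F^[ν]) ψ Filter.atTop K) :
    ∃ ξ : EuclideanSpace ℂ (Fin d), ∀ z ∈ M, ψ z = ξ := by
  exact mainTheorem11_general hM hconn.isPreconnected one_pos hκ₀ hvis.pairwise_isVisiblePair
    (fun ν => hF.iterate hFM ν) (fun ν => hFM.iterate ν) hψM hconv
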